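/- Let $\Omega_n$ be the set of $n\times n$ density matrices (positive semidefinite complex matrices of trace one). For $\rho^A,\rho^B\in\Omega_n$ let $\Gamma^Q(\rho^A,\rho^B)$ be the set of density matrices $\rho^{AB}$ on $\mathbb{C}^n\otimes\mathbb{C}^n$ with partial traces $\operatorname{tr}_B\rho^{AB}=\rho^A$ and $\operatorname{tr}_A\rho^{AB}=\rho^B$, and for a Hermitian operator $C$ on $\mathbb{C}^n\otimes\mathbb{C}^n$ put $$\mathrm{T}^Q_C(\rho^A,\rho^B)=\min_{\rho^{AB}\in\Gamma^Q(\rho^A,\rho^B)}\operatorname{tr}(C\rho^{AB}).$$ Let $C^Q=\tfrac12(\mathbb{I}-S)$, where $S$ is the SWAP operator $\mathbf{x}\otimes\mathbf{y}\mapsto\mathbf{y}\otimes\mathbf{x}$. For $C$ positive semidefinite whose kernel is exactly the space of symmetric tensors, the quantum Wasserstein-2 distance on $\Omega_n$ is $$\mathrm{W}^Q_C(\rho^A,\rho^B)=\lim_{N\to\infty}\ \inf_{\substack{\rho_1,\dots,\rho_N\in\Omega_n\\ \rho_0=\rho^A,\ \rho_{N+1}=\rho^B}}\ \sum_{i=0}^{N}\sqrt{\mathrm{T}^Q_C(\rho_i,\rho_{i+1})}.$$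 **Corollary.** Let $n=2$. The minimum defining $\mathrm{T}^Q_{C^Q}$ is attained and nonnegative on $\Omega_2\times\Omega_2$, and $\sqrt{\mathrm{T}^Q_{C^Q}}$ is a metric on the set $\Omega_2$ of qubit states: it is nonnegative, symmetric, vanishes exactly when the two states coincide, and satisfies the triangle inequality. Moreover $C^Q$ is positive semidefinite and its kernel is exactly the space of symmetric tensors, the infimum over chains is attained for each $N$, the limit as $N\to\infty$ exists, and $$\mathrm{W}^Q_{C^Q}(\rho^A,\rho^B)=\sqrt{\mathrm{T}^Q_{C^Q}(\rho^A,\rho^B)}\qquad\text{for all }\rho^A,\rho^B\in\Omega_2.$$ -/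

import Mathlib

open scoped ComplexOrder

namespace QOT

/-- A density matrix: a positive semidefinite (hence Hermitian) complex matrix of trace one. -/
def IsDensity {ι : Type*} [Fintype ι] (ρ : Matrix ι ι ℂ) : Prop :=
  ρ.PosSemidef ∧ ρ.trace = 1

/-- `Density n` is the set `Ω_n` of `n × n` density matrices. -/
abbrev Density (n : ℕ) : Type :=
  {ρ : Matrix (Fin n) (Fin n) ℂ // IsDensity ρ}

/-- The partial trace over the first factor. -/
def trA {m n : ℕ} (R : Matrix (Fin m × Fin n) (Fin m × Fin n) ℂ) : Matrix (Fin n) (Fin n) ℂ :=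
  Matrix.of fun p q => ∑ i, R (i, p) (i, q)

/-- The partial trace over the second factor. -/
def trB {m n : ℕ} (R : Matrix (Fin m × Fin n) (Fin m × Fin n) ℂ) : Matrix (Fin m) (Fin m) ℂ :=
  Matrix.of fun i j => ∑ p, R (i, p) (j, p)

/-- The set `Γ^Q(ρA, ρB)` of quantum couplings. -/
def couplings {m n : ℕ} (ρA : Density m) (ρB : Density n) :
    Set (Matrix (Fin m × Fin n) (Fin m × Fin n) ℂ) :=
  {R | IsDensity R ∧ trB R = ρA.1 ∧ trA R = ρB.1}

/-- The costs `tr (C R)` of the couplings `R`. For Hermitian `C` these traces are real. -/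
def costs {m n : ℕ} (C : Matrix (Fin m × Fin n) (Fin m × Fin n) ℂ)
    (ρA : Density m) (ρB : Density n) : Set ℝ :=
  (fun R => (C * R).trace.re) '' couplings ρA ρB

/-- The quantum optimal transport cost `T^Q_C(ρA, ρB)`, the minimum of `costs C ρA ρB`. -/
noncomputable def transport {m n : ℕ} (C : Matrix (Fin m × Fin n) (Fin m × Fin n) ℂ)
    (ρA : Density m) (ρB : Density n) : ℝ :=
  sInf (costs C ρA ρB)

/-- The SWAP operator `x ⊗ y ↦ y ⊗ x` on `ℂⁿ ⊗ ℂⁿ`. -/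
def swap (n : ℕ) : Matrix (Fin n × Fin n) (Fin n × Fin n) ℂ :=
  Matrix.of fun a b => if a = b.swap then 1 else 0

/-- The cost matrix `C^Q = (I - S) / 2`. -/
noncomputable def swapCost (n : ℕ) : Matrix (Fin n × Fin n) (Fin n × Fin n) ℂ :=
  (1 / 2 : ℂ) • (1 - swap n)

/-- The kernel of `C` is the space of symmetric matrices, where `ℂⁿ ⊗ ℂⁿ` is identified with the
space of `n × n` matrices. -/
def VanishesExactlyOnSymmetric {n : ℕ} (C : Matrix (Fin n × Fin n) (Fin n × Fin n) ℂ) : Prop :=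
  ∀ X : Fin n × Fin n → ℂ, C.mulVec X = 0 ↔ ∀ i j, X (i, j) = X (j, i)

/-- `D` is a metric on `X`. -/
structure IsMetric {X : Type*} (D : X → X → ℝ) : Prop where
  nonneg : ∀ x y, 0 ≤ D x y
  eq_zero_iff : ∀ x y, D x y = 0 ↔ x = y
  symm : ∀ x y, D x y = D y x
  triangle : ∀ x y z, D x z ≤ D x y + D y z

/-- The `D`-lengths of the chains from `x` to `y` with `N` intermediate points. -/
def chainLengths {X : Type*} (D : X → X → ℝ) (N : ℕ) (x y : X) : Set ℝ :=
  {L | ∃ z : Fin (N + 2) → X, z 0 = x ∧ z (Fin.last (N + 1)) = y ∧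
    L = ∑ i : Fin (N + 1), D (z i.castSucc) (z i.succ)}

/-- The function `D_N`, the least length of a chain with `N` intermediate points. -/
noncomputable def chainDist {X : Type*} (D : X → X → ℝ) (N : ℕ) (x y : X) : ℝ :=
  sInf (chainLengths D N x y)

/-- The induced metric `D_∞ = lim D_N`. -/
noncomputable def inducedDist {X : Type*} (D : X → X → ℝ) (x y : X) : ℝ :=
  Filter.limUnder Filter.atTop fun N => chainDist D N x y

/-- The square root of the quantum optimal transport cost on `Ω_n`. -/
noncomputable def sqrtTransport {n : ℕ} (C : Matrix (Fin n × Fin n) (Fin n × Fin n) ℂ)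
    (ρA ρB : Density n) : ℝ :=
  √(transport C ρA ρB)

/-- The quantum Wasserstein-2 distance `W^Q_C`, for positive semidefinite `C` vanishing exactly on
symmetric matrices. -/
noncomputable def wasserstein {n : ℕ} (C : Matrix (Fin n × Fin n) (Fin n × Fin n) ℂ)
    (ρA ρB : Density n) : ℝ :=
  inducedDist (sqrtTransport C) ρA ρB

end QOT

/-!
For qubits the optimal cost has the closed form
`T(ρA, ρB) = ½ max_u (√⟨u, ρA u⟩ - √⟨u, ρB u⟩)²`, the maximum being over unit vectors `u`. Hence
`√T` is the supremum distance between the functions `u ↦ √(⟨u, ρ u⟩ / 2)`, so it is a metric, and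
chains cannot be shorter than the distance between their end points.

That every coupling costs at least the right-hand side is the reverse triangle inequality for the
seminorm `Y ↦ √tr(Y R Yᴴ)` of the coupling `R`. For the converse, rotate a maximizer to `e₀` and
write `α² = ⟨e₀, ρA e₀⟩`, `β² = ⟨e₀, ρB e₀⟩`. Maximality yields `γ` such that the off-diagonal
entries of the states are `α γ` and `β γ` and `!![1, γ; star γ, 1 - α² - β²]` is positive
semidefinite. As an operator on the span of `α e₀ ⊗ e₁ + β e₁ ⊗ e₀` and `e₁ ⊗ e₁`, this matrix is a
coupling of cost `(α - β)² / 2`.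
-/

namespace QOT

open Matrix Kronecker
open scoped ComplexConjugate MatrixOrder

section Chains

variable {X : Type*} {D : X → X → ℝ}

theorem IsMetric.le_sum_chain (hD : IsMetric D) {N : ℕ} (z : Fin (N + 2) → X) :
    D (z 0) (z (Fin.last (N + 1))) ≤ ∑ i : Fin (N + 1), D (z i.castSucc) (z i.succ) := by
  induction N with
  | zero => simp
  | succ N ih =>
    rw [Fin.sum_univ_castSucc]
    exact (hD.triangle _ (z (Fin.last (N + 1)).castSucc) _).trans
      (add_le_add (ih fun i => z i.castSucc) le_rfl)

theorem IsMetric.isLeast_chainLengths (hD : IsMetric D) (N : ℕ) (x y : X) :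
    IsLeast (chainLengths D N x y) (D x y) := by
  refine ⟨⟨Fin.cons x fun _ => y, rfl, rfl, ?_⟩, ?_⟩
  · simp [Fin.sum_univ_succ, (hD.eq_zero_iff y y).2 rfl]
  · rintro L ⟨z, rfl, rfl, rfl⟩
    exact hD.le_sum_chain z

theorem IsMetric.chainDist_eq (hD : IsMetric D) (N : ℕ) (x y : X) : chainDist D N x y = D x y :=
  (hD.isLeast_chainLengths N x y).csInf_eq

theorem IsMetric.tendsto_chainDist (hD : IsMetric D) (x y : X) :
    Filter.Tendsto (fun N => chainDist D N x y) Filter.atTop (nhds (D x y)) := by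
  simp only [hD.chainDist_eq, tendsto_const_nhds]

theorem IsMetric.inducedDist_eq (hD : IsMetric D) (x y : X) : inducedDist D x y = D x y :=
  (hD.tendsto_chainDist x y).limUnder_eq

theorem IsMetric.of_isGreatest {ι : Type*} {f : X → ι → ℝ} {s : Set ι}
    (hD : ∀ x y, IsGreatest ((fun i => |f x i - f y i|) '' s) (D x y))
    (hf : ∀ x y, Set.EqOn (f x) (f y) s → x = y) : IsMetric D := by
  have le_D : ∀ x y, ∀ i ∈ s, |f x i - f y i| ≤ D x y := fun x y i hi =>
    (hD x y).2 (Set.mem_image_of_mem _ hi)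
  refine ⟨fun x y => ?_, fun x y => ⟨fun h => hf x y fun i hi => ?_, ?_⟩, fun x y => ?_,
    fun x y z => ?_⟩
  · obtain ⟨i, -, hi⟩ := (hD x y).1
    exact hi ▸ abs_nonneg _
  · exact sub_eq_zero.1 (abs_nonpos_iff.1 (h ▸ le_D x y i hi))
  · rintro rfl
    obtain ⟨i, -, hi⟩ := (hD x x).1
    simpa using hi.symm
  · refine (hD x y).unique ?_
    simpa only [abs_sub_comm] using hD y x
  · obtain ⟨i, hi, h⟩ := (hD x z).1
    exact h ▸ (abs_sub_le _ (f y i) _).trans (add_le_add (le_D x y i hi) (le_D y z i hi))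

end Chains

section Expectation

variable {ι : Type*} [Fintype ι]

/-- The unit sphere of the Hilbert space `ℂ^ι`. The type `ι → ℂ` carries the supremum norm, so the
Euclidean norm enters through the inner product. -/
def unitVectors (ι : Type*) [Fintype ι] : Set (ι → ℂ) :=
  {u | star u ⬝ᵥ u = 1}

/-- The expectation value `⟨u, A u⟩` of the observable `A` in the state vector `u`. It is real for
Hermitian `A`; in general this is its real part. -/
def expectation (A : Matrix ι ι ℂ) (u : ι → ℂ) : ℝ :=
  (star u ⬝ᵥ A *ᵥ u).re

theorem continuous_expectation (A : Matrix ι ι ℂ) : Continuous (expectation A) := by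
  unfold expectation
  fun_prop

theorem expectation_nonneg {A : Matrix ι ι ℂ} (hA : A.PosSemidef) (u : ι → ℂ) :
    0 ≤ expectation A u :=
  hA.re_dotProduct_nonneg u

theorem expectation_sub (A B : Matrix ι ι ℂ) (u : ι → ℂ) :
    expectation (A - B) u = expectation A u - expectation B u := by
  simp [expectation, sub_mulVec]

theorem expectation_smul (r : ℝ) (A : Matrix ι ι ℂ) (u : ι → ℂ) :
    expectation (r • A) u = r * expectation A u := by
  simp [expectation, smul_mulVec]

theorem expectation_smul_right (A : Matrix ι ι ℂ) (r : ℝ) (u : ι → ℂ) :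
    expectation A (r • u) = r ^ 2 * expectation A u := by
  simp [expectation, mulVec_smul]
  ring

theorem expectation_one [DecidableEq ι] {u : ι → ℂ} (hu : u ∈ unitVectors ι) :
    expectation 1 u = 1 := by
  rw [expectation, one_mulVec, hu, Complex.one_re]

theorem expectation_mul_mul_conjTranspose (A U : Matrix ι ι ℂ) (u : ι → ℂ) :
    expectation (U * A * Uᴴ) u = expectation A (Uᴴ *ᵥ u) := by
  simp only [expectation, star_mulVec, conjTranspose_conjTranspose, ← mulVec_mulVec,
    dotProduct_mulVec, vecMul_vecMul]

theorem dotProduct_star_self_eq_norm_sq (x : ι → ℂ) :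
    star x ⬝ᵥ x = ((‖WithLp.toLp 2 x‖ ^ 2 : ℝ) : ℂ) := by
  rw [dotProduct_comm, ← EuclideanSpace.inner_toLp_toLp, inner_self_eq_norm_sq_to_K]
  simp

theorem mem_unitVectors_iff_norm_eq_one {u : ι → ℂ} :
    u ∈ unitVectors ι ↔ ‖WithLp.toLp 2 u‖ = 1 := by
  rw [unitVectors, Set.mem_ofPred_eq, dotProduct_star_self_eq_norm_sq, Complex.ofReal_eq_one,
    pow_eq_one_iff_of_nonneg (norm_nonneg _) two_ne_zero]

theorem isCompact_unitVectors : IsCompact (unitVectors ι) := by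
  convert (isCompact_sphere (0 : EuclideanSpace ℂ ι) 1).image
    (PiLp.continuous_ofLp 2 fun _ : ι => ℂ) using 1
  ext u
  rw [mem_unitVectors_iff_norm_eq_one]
  exact ⟨fun h => ⟨WithLp.toLp 2 u, by simpa using h, rfl⟩, by rintro ⟨x, hx, rfl⟩; simpa using hx⟩

theorem posSemidef_of_expectation_nonneg {A : Matrix ι ι ℂ} (hA : A.IsHermitian)
    (h : ∀ u ∈ unitVectors ι, 0 ≤ expectation A u) : A.PosSemidef := by
  suffices h' : ∀ x, 0 ≤ expectation A x from .of_dotProduct_mulVec_nonneg hA fun x =>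
    Complex.nonneg_iff.2 ⟨h' x, (hA.im_star_dotProduct_mulVec_self x).symm⟩
  intro x
  rcases eq_or_ne x 0 with rfl | hx
  · simp [expectation]
  set r := ‖WithLp.toLp 2 x‖
  have hr : r ≠ 0 := by simpa [r] using hx
  have hunit : r⁻¹ • x ∈ unitVectors ι := by
    rw [mem_unitVectors_iff_norm_eq_one, WithLp.toLp_smul, norm_smul, norm_inv, norm_norm,
      inv_mul_cancel₀ hr]
  rw [← smul_inv_smul₀ hr x, expectation_smul_right]
  exact mul_nonneg (sq_nonneg r) (h _ hunit)

theorem eq_of_expectation_eq {A B : Matrix ι ι ℂ} (hA : A.IsHermitian) (hB : B.IsHermitian)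
    (h : Set.EqOn (expectation A) (expectation B) (unitVectors ι)) : A = B := by
  refine le_antisymm (posSemidef_of_expectation_nonneg (hB.sub hA) fun u hu => ?_)
    (posSemidef_of_expectation_nonneg (hA.sub hB) fun u hu => ?_) <;>
  rw [expectation_sub, h hu, sub_self]

end Expectation

section PosSemidef

variable {ι : Type*} [Fintype ι]

theorem re_trace_mul_nonneg {A B : Matrix ι ι ℂ} (hA : A.PosSemidef) (hB : B.PosSemidef) :
    0 ≤ (A * B).trace.re := by
  classical
  obtain ⟨Y, rfl⟩ := CStarAlgebra.nonneg_iff_eq_star_mul_self.1 hB.nonneg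
  rw [star_eq_conjTranspose, ← mul_assoc, trace_mul_comm, ← mul_assoc]
  exact (Complex.nonneg_iff.1 (hA.mul_mul_conjTranspose_same Y).trace_nonneg).1

theorem abs_sqrt_trace_sub_sqrt_trace_le {R : Matrix ι ι ℂ} (hR : R.PosSemidef)
    (Y Z : Matrix ι ι ℂ) :
    |√(Y * R * Yᴴ).trace.re - √(Z * R * Zᴴ).trace.re| ≤
      √((Y - Z) * R * (Y - Z)ᴴ).trace.re := by
  let := R.toMatrixSeminormedAddCommGroup hR
  exact abs_norm_sub_norm_le Y Z

theorem IsDensity.mul_mul_conjTranspose [DecidableEq ι] {ρ U : Matrix ι ι ℂ} (hρ : IsDensity ρ)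
    (hU : Uᴴ * U = 1) : IsDensity (U * ρ * Uᴴ) :=
  ⟨hρ.1.mul_mul_conjTranspose_same U, by rw [trace_mul_comm, ← mul_assoc, hU, one_mul, hρ.2]⟩

end PosSemidef

section PartialTrace

variable {m n : ℕ}

theorem trace_trB_mul (R : Matrix (Fin m × Fin n) (Fin m × Fin n) ℂ)
    (X : Matrix (Fin m) (Fin m) ℂ) : (trB R * X).trace = (R * (X ⊗ₖ 1)).trace := by
  simp only [trace, diag, mul_apply, trB, of_apply, Fintype.sum_prod_type, kroneckerMap_apply,
    one_apply, mul_ite, mul_one, mul_zero, Finset.sum_ite_eq', Finset.mem_univ, if_true,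
    Finset.sum_mul]
  exact Finset.sum_congr rfl fun i _ => Finset.sum_comm

theorem trA_eq_trB_submatrix_swap (R : Matrix (Fin m × Fin n) (Fin m × Fin n) ℂ) :
    trA R = trB (R.submatrix Prod.swap Prod.swap) :=
  rfl

theorem trace_trA_mul (R : Matrix (Fin m × Fin n) (Fin m × Fin n) ℂ)
    (X : Matrix (Fin n) (Fin n) ℂ) : (trA R * X).trace = (R * (1 ⊗ₖ X)).trace := by
  have hX : X ⊗ₖ (1 : Matrix (Fin m) (Fin m) ℂ) =
      (1 ⊗ₖ X).submatrix (Equiv.prodComm _ _) (Equiv.prodComm _ _) := by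
    ext
    simp [one_apply, mul_comm]
  rw [trA_eq_trB_submatrix_swap, trace_trB_mul, hX, ← Equiv.coe_prodComm, submatrix_mul_equiv]
  exact (Equiv.prodComm _ _).sum_comp (R * (1 ⊗ₖ X)).diag

theorem trace_trB (R : Matrix (Fin m × Fin n) (Fin m × Fin n) ℂ) : (trB R).trace = R.trace := by
  simpa using trace_trB_mul R 1

theorem mem_couplings_iff {ρA : Density m} {ρB : Density n}
    {R : Matrix (Fin m × Fin n) (Fin m × Fin n) ℂ} :
    R ∈ couplings ρA ρB ↔ R.PosSemidef ∧ trB R = ρA.1 ∧ trA R = ρB.1 :=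
  ⟨fun h => ⟨h.1.1, h.2⟩, fun h => ⟨⟨h.1, by rw [← trace_trB, h.2.1, ρA.2.2]⟩, h.2⟩⟩

theorem trB_kronecker_conj {U : Matrix (Fin m) (Fin m) ℂ} {V : Matrix (Fin n) (Fin n) ℂ}
    (hV : Vᴴ * V = 1) (R : Matrix (Fin m × Fin n) (Fin m × Fin n) ℂ) :
    trB ((U ⊗ₖ V) * R * (U ⊗ₖ V)ᴴ) = U * trB R * Uᴴ := by
  refine ext_iff_trace_mul_right.2 fun X => ?_
  calc (trB ((U ⊗ₖ V) * R * (U ⊗ₖ V)ᴴ) * X).trace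
    _ = (R * ((U ⊗ₖ V)ᴴ * (X ⊗ₖ 1) * (U ⊗ₖ V))).trace := by
      rw [trace_trB_mul, mul_assoc, mul_assoc, trace_mul_comm]
      simp only [mul_assoc]
    _ = (R * ((Uᴴ * X * U) ⊗ₖ 1)).trace := by
      rw [conjTranspose_kronecker, ← mul_kronecker_mul, ← mul_kronecker_mul, mul_one, hV]
    _ = (U * trB R * Uᴴ * X).trace := by
      rw [← trace_trB_mul, mul_assoc U, mul_assoc U, trace_mul_comm U]
      simp only [mul_assoc]

theorem trA_kronecker_conj {U : Matrix (Fin m) (Fin m) ℂ} {V : Matrix (Fin n) (Fin n) ℂ}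
    (hU : Uᴴ * U = 1) (R : Matrix (Fin m × Fin n) (Fin m × Fin n) ℂ) :
    trA ((U ⊗ₖ V) * R * (U ⊗ₖ V)ᴴ) = V * trA R * Vᴴ := by
  refine ext_iff_trace_mul_right.2 fun X => ?_
  calc (trA ((U ⊗ₖ V) * R * (U ⊗ₖ V)ᴴ) * X).trace
    _ = (R * ((U ⊗ₖ V)ᴴ * (1 ⊗ₖ X) * (U ⊗ₖ V))).trace := by
      rw [trace_trA_mul, mul_assoc, mul_assoc, trace_mul_comm]
      simp only [mul_assoc]
    _ = (R * (1 ⊗ₖ (Vᴴ * X * V))).trace := by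
      rw [conjTranspose_kronecker, ← mul_kronecker_mul, ← mul_kronecker_mul, mul_one, hU]
    _ = (V * trA R * Vᴴ * X).trace := by
      rw [← trace_trA_mul, mul_assoc V, mul_assoc V, trace_mul_comm V]
      simp only [mul_assoc]

theorem transport_nonneg {C : Matrix (Fin m × Fin n) (Fin m × Fin n) ℂ} (hC : C.PosSemidef)
    (ρA : Density m) (ρB : Density n) : 0 ≤ transport C ρA ρB := by
  refine Real.sInf_nonneg ?_
  rintro _ ⟨R, hR, rfl⟩
  exact re_trace_mul_nonneg hC hR.1.1

end PartialTrace

section Swap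

variable {n : ℕ}

theorem swap_mul (M : Matrix (Fin n × Fin n) (Fin n × Fin n) ℂ) :
    swap n * M = M.submatrix Prod.swap id := by
  ext a b
  have h : ∀ c, a = c.swap ↔ c = a.swap := fun c => by
    rw [eq_comm, Prod.swap_eq_iff_eq_swap]
  simp [swap, mul_apply, h]

theorem mul_swap (M : Matrix (Fin n × Fin n) (Fin n × Fin n) ℂ) :
    M * swap n = M.submatrix id Prod.swap := by
  ext a b
  simp [swap, mul_apply]

theorem swap_mul_swap : swap n * swap n = 1 := by
  rw [swap_mul]
  ext a b
  simp [swap, one_apply]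

theorem swap_isHermitian : (swap n).IsHermitian := by
  ext a b
  have h : b = a.swap ↔ a = b.swap := by rw [eq_comm, Prod.swap_eq_iff_eq_swap]
  simp [swap, h, apply_ite]

theorem swap_mul_kronecker (X Y : Matrix (Fin n) (Fin n) ℂ) :
    swap n * (X ⊗ₖ Y) = (Y ⊗ₖ X) * swap n := by
  ext a b
  simp [swap_mul, mul_swap, mul_comm]

theorem swap_mul_kronecker_mul_swap (X Y : Matrix (Fin n) (Fin n) ℂ) :
    swap n * (X ⊗ₖ Y) * swap n = Y ⊗ₖ X := by
  rw [swap_mul_kronecker, mul_assoc, swap_mul_swap, mul_one]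

theorem swap_mul_swapCost : swap n * swapCost n = -swapCost n := by
  rw [swapCost, mul_smul_comm, mul_sub, swap_mul_swap, mul_one, ← smul_neg, neg_sub]

theorem swapCost_mul_swap : swapCost n * swap n = -swapCost n := by
  rw [swapCost, smul_mul_assoc, sub_mul, swap_mul_swap, one_mul, ← smul_neg, neg_sub]

theorem swapCost_mul_self : swapCost n * swapCost n = swapCost n := by
  nth_rw 1 [swapCost]
  rw [smul_mul_assoc, sub_mul, one_mul, swap_mul_swapCost, sub_neg_eq_add, ← two_smul ℂ, smul_smul]
  norm_num

theorem swapCost_isHermitian : (swapCost n).IsHermitian := by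
  simp [IsHermitian, swapCost, conjTranspose_smul, swap_isHermitian.eq]

theorem swapCost_posSemidef : (swapCost n).PosSemidef := by
  have h := posSemidef_conjTranspose_mul_self (swapCost n)
  rwa [swapCost_isHermitian.eq, swapCost_mul_self] at h

theorem swapCost_mulVec_apply (x : Fin n × Fin n → ℂ) (a : Fin n × Fin n) :
    (swapCost n *ᵥ x) a = (x a - x a.swap) / 2 := by
  have h : (swap n *ᵥ x) a = x a.swap := by
    simpa [mul_apply, mulVec, dotProduct] using congr_fun₂ (swap_mul (replicateCol _ x)) a a
  simp [swapCost, smul_mulVec, sub_mulVec, h]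
  ring

theorem swapCost_vanishesExactlyOnSymmetric : VanishesExactlyOnSymmetric (swapCost n) := by
  intro x
  simp [funext_iff, swapCost_mulVec_apply, sub_eq_zero]

theorem trace_swapCost_mul (R : Matrix (Fin n × Fin n) (Fin n × Fin n) ℂ) :
    (swapCost n * R).trace = (R.trace - ∑ a, R a.swap a) / 2 := by
  simp only [swapCost, smul_mul_assoc, sub_mul, one_mul, trace_smul, trace_sub, swap_mul,
    smul_eq_mul, one_div_mul_eq_div]
  rfl

theorem swapCost_commute_kronecker_self (U : Matrix (Fin n) (Fin n) ℂ) :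
    Commute (swapCost n) (U ⊗ₖ U) :=
  ((Commute.one_left _).sub_left (swap_mul_kronecker U U)).smul_left _

end Swap

section UnitaryInvariance

variable {n : ℕ}

/-- The unitary group acts on states by `U • ρ = U ρ Uᴴ`. -/
instance : MulAction (unitaryGroup (Fin n) ℂ) (Density n) where
  smul U ρ := ⟨U * ρ.1 * (U : Matrix (Fin n) (Fin n) ℂ)ᴴ,
    ρ.2.mul_mul_conjTranspose (Unitary.coe_star_mul_self U)⟩
  one_smul ρ := Subtype.ext <| by
    change 1 * ρ.1 * 1ᴴ = ρ.1
    simp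
  mul_smul U V ρ := Subtype.ext <| by
    change (U * V : Matrix (Fin n) (Fin n) ℂ) * ρ.1 * (U * V : Matrix (Fin n) (Fin n) ℂ)ᴴ =
      U * (V * ρ.1 * (V : Matrix (Fin n) (Fin n) ℂ)ᴴ) * (U : Matrix (Fin n) (Fin n) ℂ)ᴴ
    simp only [conjTranspose_mul, mul_assoc]

theorem Density.coe_smul (U : unitaryGroup (Fin n) ℂ) (ρ : Density n) :
    (U • ρ).1 = U * ρ.1 * (U : Matrix (Fin n) (Fin n) ℂ)ᴴ :=
  rfl

theorem expectation_inv_smul (U : unitaryGroup (Fin n) ℂ) (ρ : Density n) (x : Fin n → ℂ) :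
    expectation (U⁻¹ • ρ).1 x = expectation ρ.1 (U.1 *ᵥ x) := by
  rw [Density.coe_smul, expectation_mul_mul_conjTranspose, UnitaryGroup.inv_val,
    star_eq_conjTranspose, conjTranspose_conjTranspose]

theorem mulVec_mem_unitVectors (U : unitaryGroup (Fin n) ℂ) {x : Fin n → ℂ}
    (hx : x ∈ unitVectors (Fin n)) : U.1 *ᵥ x ∈ unitVectors (Fin n) := by
  rw [unitVectors, Set.mem_ofPred_eq, star_mulVec, dotProduct_mulVec, vecMul_vecMul,
    ← star_eq_conjTranspose, Unitary.coe_star_mul_self, vecMul_one, hx]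

theorem costs_subset_costs_smul (ρA ρB : Density n) (U : unitaryGroup (Fin n) ℂ) :
    costs (swapCost n) ρA ρB ⊆ costs (swapCost n) (U • ρA) (U • ρB) := by
  rintro _ ⟨R, hR, rfl⟩
  have hU : (U : Matrix (Fin n) (Fin n) ℂ)ᴴ * U = 1 := Unitary.coe_star_mul_self U
  set W := (U : Matrix (Fin n) (Fin n) ℂ) ⊗ₖ (U : Matrix (Fin n) (Fin n) ℂ)
  have hW : Wᴴ * W = 1 := by
    rw [conjTranspose_kronecker, ← mul_kronecker_mul, hU, one_kronecker_one]
  refine ⟨W * R * Wᴴ, mem_couplings_iff.2 ⟨hR.1.1.mul_mul_conjTranspose_same W, ?_, ?_⟩, ?_⟩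
  · rw [trB_kronecker_conj hU, hR.2.1, Density.coe_smul]
  · rw [trA_kronecker_conj hU, hR.2.2, Density.coe_smul]
  · dsimp only
    rw [← mul_assoc, ← mul_assoc, (swapCost_commute_kronecker_self _).eq, trace_mul_comm,
      ← mul_assoc, ← mul_assoc, hW, one_mul]

theorem costs_smul (ρA ρB : Density n) (U : unitaryGroup (Fin n) ℂ) :
    costs (swapCost n) (U • ρA) (U • ρB) = costs (swapCost n) ρA ρB := by
  refine (costs_subset_costs_smul ρA ρB U).antisymm' ?_
  simpa only [inv_smul_smul] using costs_subset_costs_smul (U • ρA) (U • ρB) U⁻¹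

end UnitaryInvariance

section LowerBound

variable {n : ℕ}

/-- The operator `|u⟩⟨u|`, which for a unit vector `u` is the orthogonal projection onto `ℂ u`. -/
def rankOne {ι : Type*} (u : ι → ℂ) : Matrix ι ι ℂ :=
  vecMulVec u (star u)

theorem rankOne_isHermitian {ι : Type*} (u : ι → ℂ) : (rankOne u).IsHermitian := by
  rw [IsHermitian, rankOne, conjTranspose_vecMulVec, star_star]

theorem rankOne_mul_self {ι : Type*} [Fintype ι] {u : ι → ℂ} (hu : u ∈ unitVectors ι) :
    rankOne u * rankOne u = rankOne u := by
  rw [rankOne, vecMulVec_mul_vecMulVec, hu, one_smul]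

theorem trace_mul_rankOne_re {ι : Type*} [Fintype ι] (A : Matrix ι ι ℂ) (u : ι → ℂ) :
    (A * rankOne u).trace.re = expectation A u := by
  rw [rankOne, mul_vecMulVec, trace_vecMulVec, dotProduct_comm, expectation]

theorem posSemidef_one_sub_rankOne {ι : Type*} [Fintype ι] [DecidableEq ι] {u : ι → ℂ}
    (hu : u ∈ unitVectors ι) : (1 - rankOne u).PosSemidef := by
  have hP : 1 - rankOne u = (1 - rankOne u)ᴴ * (1 - rankOne u) := by
    rw [conjTranspose_sub, conjTranspose_one, (rankOne_isHermitian u).eq, mul_sub, mul_one, sub_mul,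
      one_mul, rankOne_mul_self hu, sub_self, sub_zero]
  exact hP ▸ posSemidef_conjTranspose_mul_self _

theorem swapCost_mul_kronecker_rankOne (u : Fin n → ℂ) :
    swapCost n * (rankOne u ⊗ₖ rankOne u) = 0 := by
  have h : swap n * (rankOne u ⊗ₖ rankOne u) = rankOne u ⊗ₖ rankOne u := by
    rw [swap_mul]
    ext a b
    simp [rankOne, vecMulVec_apply]
    ring
  rw [swapCost, smul_mul_assoc, sub_mul, one_mul, h, sub_self, smul_zero]

theorem swapCost_mul_one_kronecker_mul_swapCost (X : Matrix (Fin n) (Fin n) ℂ) :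
    swapCost n * (1 ⊗ₖ X) * swapCost n = swapCost n * (X ⊗ₖ 1) * swapCost n := by
  calc swapCost n * (1 ⊗ₖ X) * swapCost n
    _ = (swapCost n * swap n) * (X ⊗ₖ 1) * (swap n * swapCost n) := by
      rw [← swap_mul_kronecker_mul_swap]
      simp only [mul_assoc]
    _ = swapCost n * (X ⊗ₖ 1) * swapCost n := by
      rw [swapCost_mul_swap, swap_mul_swapCost, neg_mul, neg_mul_neg]

theorem swapCost_sub_compression (u : Fin n → ℂ) :
    swapCost n - (2 : ℝ) • (swapCost n * (rankOne u ⊗ₖ 1) * swapCost n) =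
      swapCost n * ((1 - rankOne u) ⊗ₖ (1 - rankOne u)) * swapCost n := by
  have hexp : (1 - rankOne u) ⊗ₖ (1 - rankOne u) =
      1 - rankOne u ⊗ₖ 1 - 1 ⊗ₖ rankOne u + rankOne u ⊗ₖ rankOne u := by
    rw [← one_kronecker_one]
    ext a b
    simp only [kroneckerMap_apply, Matrix.sub_apply, Matrix.add_apply]
    ring
  rw [hexp, mul_add, swapCost_mul_kronecker_rankOne, add_zero, mul_sub, mul_sub, mul_one, sub_mul,
    sub_mul, swapCost_mul_self, swapCost_mul_one_kronecker_mul_swapCost, two_smul]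
  abel

theorem two_smul_compression_le_swapCost {u : Fin n → ℂ} (hu : u ∈ unitVectors (Fin n)) :
    (2 : ℝ) • (swapCost n * (rankOne u ⊗ₖ 1) * swapCost n) ≤ swapCost n := by
  have hP := posSemidef_one_sub_rankOne hu
  have h := (hP.kronecker hP).conjTranspose_mul_mul_same (swapCost n)
  rwa [swapCost_isHermitian.eq, ← swapCost_sub_compression] at h

/-- In the seminorm `Y ↦ √tr(Y R Yᴴ)` the operators `P ⊗ 1` and `(P ⊗ 1) S`, where `P = |u⟩⟨u|`,
have the lengths `√⟨u, ρA u⟩` and `√⟨u, ρB u⟩`, and their difference is `2 (P ⊗ 1) C^Q`. -/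
theorem sq_sub_sqrt_expectation_le_of_mem_costs {ρA ρB : Density n} {L : ℝ}
    (hL : L ∈ costs (swapCost n) ρA ρB) {u : Fin n → ℂ} (hu : u ∈ unitVectors (Fin n)) :
    (√(expectation ρA.1 u) - √(expectation ρB.1 u)) ^ 2 / 2 ≤ L := by
  obtain ⟨R, ⟨⟨hR, -⟩, hA, hB⟩, rfl⟩ := hL
  set E : Matrix (Fin n × Fin n) (Fin n × Fin n) ℂ := rankOne u ⊗ₖ 1 with hE
  have hEE : Eᴴ * E = E := by
    rw [hE, conjTranspose_kronecker, (rankOne_isHermitian u).eq, conjTranspose_one,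
      ← mul_kronecker_mul, rankOne_mul_self hu, one_mul]
  have trace_conj : ∀ Y : Matrix (Fin n × Fin n) (Fin n × Fin n) ℂ,
      (E * Y * R * (E * Y)ᴴ).trace = (Yᴴ * E * Y * R).trace := fun Y => by
    rw [trace_mul_comm, conjTranspose_mul, ← mul_assoc, mul_assoc Yᴴ, ← mul_assoc Eᴴ, hEE,
      ← mul_assoc]
  have length_A : (E * 1 * R * (E * 1)ᴴ).trace.re = expectation ρA.1 u := by
    rw [trace_conj, conjTranspose_one, one_mul, mul_one, trace_mul_comm, hE, ← trace_trB_mul, hA,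
      trace_mul_rankOne_re]
  have length_B : (E * swap n * R * (E * swap n)ᴴ).trace.re = expectation ρB.1 u := by
    rw [trace_conj, swap_isHermitian.eq, hE, swap_mul_kronecker_mul_swap, trace_mul_comm,
      ← trace_trA_mul, hB, trace_mul_rankOne_re]
  have difference : E * 1 - E * swap n = E * ((2 : ℝ) • swapCost n) := by
    have h : (2 : ℝ) • swapCost n = 1 - swap n := by
      rw [swapCost, ← smul_assoc]
      simp
    rw [h, mul_sub]
  have hdist : ((E * 1 - E * swap n) * R * (E * 1 - E * swap n)ᴴ).trace.re ≤
      2 * (swapCost n * R).trace.re := by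
    have h := re_trace_mul_nonneg (two_smul_compression_le_swapCost hu) hR
    rw [difference, trace_conj, conjTranspose_smul, swapCost_isHermitian.eq]
    simp only [← hE, sub_mul, smul_mul_assoc, mul_smul_comm, trace_sub, trace_smul,
      Complex.sub_re, Complex.smul_re, smul_eq_mul, star_trivial] at h ⊢
    linarith
  have htri := abs_sqrt_trace_sub_sqrt_trace_le hR (E * 1) (E * swap n)
  rw [length_A, length_B] at htri
  have hcost := re_trace_mul_nonneg swapCost_posSemidef hR
  have hsq := (Real.le_sqrt (abs_nonneg _) (by linarith)).1 (htri.trans (Real.sqrt_le_sqrt hdist))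
  rw [sq_abs] at hsq
  exact div_le_of_le_mul₀ zero_le_two hcost (by linarith)

end LowerBound

section EqualStates

variable {n : ℕ}

theorem Density.exists_smul_eq_diagonal (ρ : Density n) :
    ∃ (U : unitaryGroup (Fin n) ℂ) (d : Fin n → ℂ), (U • ρ).1 = diagonal d := by
  have hρ := ρ.2.1.isHermitian
  exact ⟨star hρ.eigenvectorUnitary, _, hρ.conjStarAlgAut_star_eigenvectorUnitary⟩

theorem zero_mem_costs_self_of_diagonal {ρ : Density n} {d : Fin n → ℂ} (hρ : ρ.1 = diagonal d) :
    0 ∈ costs (swapCost n) ρ ρ := by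
  have hd : ∀ i, 0 ≤ d i := fun i => by simpa [hρ] using ρ.2.1.diag_nonneg (i := i)
  refine ⟨diagonal fun a => if a.1 = a.2 then d a.1 else 0,
    mem_couplings_iff.2 ⟨.diagonal fun a => ?_, ?_, ?_⟩, ?_⟩
  · dsimp only
    split_ifs
    exacts [hd a.1, le_rfl]
  · ext i j
    simp [trB, hρ, diagonal_apply]
  · ext i j
    simp [trA, hρ, diagonal_apply]
  · dsimp only
    rw [trace_swapCost_mul, trace, ← Finset.sum_sub_distrib, Finset.sum_eq_zero, zero_div,
      Complex.zero_re]
    rintro ⟨i, j⟩ -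
    rcases eq_or_ne i j with rfl | hij
    · simp
    · simp [hij]

theorem zero_mem_costs_self (ρ : Density n) : 0 ∈ costs (swapCost n) ρ ρ := by
  obtain ⟨U, d, hd⟩ := ρ.exists_smul_eq_diagonal
  rw [← costs_smul ρ ρ U]
  exact zero_mem_costs_self_of_diagonal hd

end EqualStates

theorem apply_eq_zero_of_diag_eq_zero {ι : Type*} [Finite ι] {A : Matrix ι ι ℂ}
    (hA : A.PosSemidef) {i : ι} (h : A i i = 0) (j : ι) : A i j = 0 := by
  classical
  cases nonempty_fintype ι
  have hker : A *ᵥ Pi.single i 1 = 0 := (hA.dotProduct_mulVec_zero_iff _).1 (by simpa using h)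
  have hji : A j i = 0 := by simpa using congr_fun hker j
  rw [← hA.isHermitian.apply, hji, star_zero]

section StandardBasis

variable {ι : Type*} [Fintype ι] [DecidableEq ι]

theorem single_mem_unitVectors (i : ι) : Pi.single i 1 ∈ unitVectors ι := by
  simp [unitVectors]

theorem expectation_single (A : Matrix ι ι ℂ) (i : ι) :
    expectation A (Pi.single i 1) = (A i i).re := by
  simp [expectation]

end StandardBasis

section UpperBound

/-- The trace-one Hermitian matrix with first row `(α², c)`. Parametrizing the diagonal by its
square root `α` makes the optimal coupling rational in the parameters. -/
def qubitMatrix (α : ℝ) (c : ℂ) : Matrix (Fin 2) (Fin 2) ℂ :=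
  !![(α : ℂ) ^ 2, c; star c, 1 - (α : ℂ) ^ 2]

/-- The operator which, with respect to the vectors `α e₀ ⊗ e₁ + β e₁ ⊗ e₀` and `e₁ ⊗ e₁`, gives a
coupling of the states `qubitMatrix α (α * γ)` and `qubitMatrix β (β * γ)`. -/
def couplingMatrix (α β : ℝ) (γ : ℂ) : Matrix (Fin 2) (Fin 2) ℂ :=
  !![1, γ; star γ, 1 - (α : ℂ) ^ 2 - (β : ℂ) ^ 2]

theorem posSemidef_of_sq_sqrt_sub_sqrt_le {ι : Type*} [Fintype ι] [DecidableEq ι]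
    {A B : Matrix ι ι ℂ} (hA : A.PosSemidef) (hB : B.PosSemidef) {α β : ℝ} (hα : 0 ≤ α)
    (hβ : 0 ≤ β)
    (h : ∀ u ∈ unitVectors ι, (√(expectation A u) - √(expectation B u)) ^ 2 ≤ (α - β) ^ 2) :
    ((α * β * (α - β) ^ 2) • (1 : Matrix ι ι ℂ) -
      (α - β) • (β • A - α • B)).PosSemidef := by
  refine posSemidef_of_expectation_nonneg ?_ fun u hu => ?_
  · have hr : ∀ (r : ℝ) {M : Matrix ι ι ℂ}, M.IsHermitian → (r • M).IsHermitian := fun r M hM => by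
      rw [IsHermitian, conjTranspose_smul, hM.eq, star_trivial]
    exact (hr _ isHermitian_one).sub (hr _ ((hr _ hA.isHermitian).sub (hr _ hB.isHermitian)))
  · simp only [expectation_sub, expectation_smul, expectation_one hu]
    rw [← Real.sq_sqrt (expectation_nonneg hA u), ← Real.sq_sqrt (expectation_nonneg hB u)]
    set p := √(expectation A u)
    set q := √(expectation B u)
    have identity : α * β * (α - β) ^ 2 * 1 - (α - β) * (β * p ^ 2 - α * q ^ 2) =
        α * β * ((α - β) ^ 2 - (p - q) ^ 2) + (β * p - α * q) ^ 2 := by ring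
    rw [identity]
    exact add_nonneg (mul_nonneg (mul_nonneg hα hβ) (sub_nonneg.2 (h u hu))) (sq_nonneg _)

theorem mem_costs_of_posSemidef_couplingMatrix {ρA ρB : Density 2} {α β : ℝ} {γ : ℂ}
    (hA : ρA.1 = qubitMatrix α (α * γ)) (hB : ρB.1 = qubitMatrix β (β * γ))
    (hM : (couplingMatrix α β γ).PosSemidef) :
    (α - β) ^ 2 / 2 ∈ costs (swapCost 2) ρA ρB := by
  let W : Matrix (Fin 2 × Fin 2) (Fin 2) ℂ :=
    of fun a => !![![0, 0], ![(α : ℂ), 0]; ![(β : ℂ), 0], ![0, 1]] a.1 a.2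
  refine ⟨W * couplingMatrix α β γ * Wᴴ,
    mem_couplings_iff.2 ⟨hM.mul_mul_conjTranspose_same W, ?_, ?_⟩, ?_⟩
  · ext i j
    fin_cases i <;> fin_cases j <;>
    simp [hA, qubitMatrix, trB, W, couplingMatrix, mul_apply, Fin.sum_univ_two] <;> ring
  · ext i j
    fin_cases i <;> fin_cases j <;>
    simp [hB, qubitMatrix, trA, W, couplingMatrix, mul_apply, Fin.sum_univ_two] <;> ring
  · have htrace : (swapCost 2 * (W * couplingMatrix α β γ * Wᴴ)).trace =
        (((α - β) ^ 2 / 2 : ℝ) : ℂ) := by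
      rw [trace_swapCost_mul]
      simp [trace, Fintype.sum_prod_type, W, couplingMatrix, mul_apply]
      ring
    exact congrArg Complex.re htrace

theorem Density.eq_of_expectation_single_zero (ρ : Density 2) {α : ℝ}
    (hα : expectation ρ.1 (Pi.single 0 1) = α ^ 2) : ρ.1 = qubitMatrix α (ρ.1 0 1) := by
  have hρ := ρ.2.1.isHermitian
  have h00 : ρ.1 0 0 = (α : ℂ) ^ 2 := by
    rw [← hρ.coe_re_apply_self 0, RCLike.re_eq_complex_re, ← expectation_single, hα]
    push_cast
    rfl
  have h11 : ρ.1 1 1 = 1 - (α : ℂ) ^ 2 := by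
    rw [← h00, ← ρ.2.2, trace_fin_two, add_sub_cancel_left]
  rw [qubitMatrix, ← h11, ← h00, hρ.apply 1 0]
  exact eta_fin_two _

theorem posSemidef_couplingMatrix {α β : ℝ} {γ : ℂ} (hsub : (α - β : ℂ) ≠ 0)
    (hadd : (α + β : ℂ) ≠ 0)
    (hG : ((β * α * (β - α) ^ 2) • (1 : Matrix (Fin 2) (Fin 2) ℂ) -
      (β - α) • (α • qubitMatrix α (α * γ) - β • qubitMatrix β (β * γ))).PosSemidef) :
    (couplingMatrix α β γ).PosSemidef := by
  set T : Matrix (Fin 2) (Fin 2) ℂ := diagonal ![((α + β : ℝ) : ℂ)⁻¹, 1]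
  convert (hG.conjTranspose_mul_mul_same T).smul (inv_nonneg.2 (sq_nonneg (α - β))) using 1
  ext i j
  fin_cases i <;> fin_cases j <;>
  simp [T, couplingMatrix, qubitMatrix, one_fin_two] <;> field_simp <;> ring

/-- Optimality of `e₀` is used to first order, which makes the off-diagonal entries of `ρA` and `ρB`
proportional to `α` and `β`, and to second order, which makes `couplingMatrix` positive
semidefinite. -/
theorem mem_costs_of_isMaxOn_single_zero {ρA ρB : Density 2} {α β : ℝ} (hα : 0 ≤ α) (hβ : 0 ≤ β)
    (hne : α ≠ β) (hA : expectation ρA.1 (Pi.single 0 1) = α ^ 2)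
    (hB : expectation ρB.1 (Pi.single 0 1) = β ^ 2)
    (h : ∀ u ∈ unitVectors (Fin 2),
      (√(expectation ρA.1 u) - √(expectation ρB.1 u)) ^ 2 ≤ (α - β) ^ 2) :
    (α - β) ^ 2 / 2 ∈ costs (swapCost 2) ρA ρB := by
  replace hA := ρA.eq_of_expectation_single_zero hA
  replace hB := ρB.eq_of_expectation_single_zero hB
  set c := ρA.1 0 1
  set d := ρB.1 0 1
  have hsub : (α - β : ℂ) ≠ 0 := by exact_mod_cast sub_ne_zero.2 hne
  have hadd : (α + β : ℂ) ≠ 0 := by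
    norm_cast
    contrapose! hne
    linarith
  have hF := posSemidef_of_sq_sqrt_sub_sqrt_le ρA.2.1 ρB.2.1 hα hβ h
  have hG := posSemidef_of_sq_sqrt_sub_sqrt_le ρA.2.1 ρB.2.1 hβ hα fun u hu =>
    (h u hu).trans_eq (sub_sq_comm α β)
  rw [hA, hB] at hF hG
  have first_order : (β : ℂ) * c = α * d := by
    have h01 := apply_eq_zero_of_diag_eq_zero hF (i := 0) (by simp [qubitMatrix]; ring) 1
    simpa [qubitMatrix, hsub, sub_eq_zero] using h01
  obtain ⟨γ, hc, hd⟩ : ∃ γ, c = α * γ ∧ d = β * γ :=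
    ⟨(c - d) / (α - β), by field_simp; linear_combination -first_order,
      by field_simp; linear_combination -first_order⟩
  rw [hc] at hA hG
  rw [hd] at hB hG
  exact mem_costs_of_posSemidef_couplingMatrix hA hB (posSemidef_couplingMatrix hsub hadd hG)

end UpperBound

section Qubits

theorem Density.ext_sqrt_expectation {n : ℕ} {ρ σ : Density n}
    (h : ∀ u ∈ unitVectors (Fin n), √(expectation ρ.1 u) = √(expectation σ.1 u)) : ρ = σ :=
  Subtype.ext <| eq_of_expectation_eq ρ.2.1.isHermitian σ.2.1.isHermitian fun u hu =>
    (Real.sqrt_inj (expectation_nonneg ρ.2.1 u) (expectation_nonneg σ.2.1 u)).1 (h u hu)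

theorem exists_unitary_mulVec_single {u : Fin 2 → ℂ} (hu : u ∈ unitVectors (Fin 2)) :
    ∃ U : unitaryGroup (Fin 2) ℂ, U.1 *ᵥ Pi.single 0 1 = u := by
  have hnorm : conj (u 0) * u 0 + conj (u 1) * u 1 = 1 := by
    simpa [unitVectors, dotProduct, Fin.sum_univ_two] using hu
  refine ⟨⟨!![u 0, -conj (u 1); u 1, conj (u 0)], mem_unitaryGroup_iff'.2 ?_⟩, ?_⟩
  · ext i j
    fin_cases i <;> fin_cases j
    · simpa [mul_apply, Fin.sum_univ_two, star_apply] using hnorm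
    · simp [mul_apply, Fin.sum_univ_two, star_apply, mul_comm]
    · simp [mul_apply, Fin.sum_univ_two, star_apply, mul_comm]
    · simpa [mul_apply, Fin.sum_univ_two, star_apply, mul_comm, add_comm] using hnorm
  · ext i
    fin_cases i <;> simp

theorem exists_isLeast_costs (ρA ρB : Density 2) : ∃ u ∈ unitVectors (Fin 2),
    IsLeast (costs (swapCost 2) ρA ρB)
      ((√(expectation ρA.1 u) - √(expectation ρB.1 u)) ^ 2 / 2) := by
  obtain ⟨u, hu, hmax⟩ := isCompact_unitVectors.exists_isMaxOn ⟨_, single_mem_unitVectors 0⟩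
    (((continuous_expectation ρA.1).sqrt.sub (continuous_expectation ρB.1).sqrt).pow 2).continuousOn
  refine ⟨u, hu, ?_, fun L hL => sq_sub_sqrt_expectation_le_of_mem_costs hL hu⟩
  rcases eq_or_ne (√(expectation ρA.1 u)) (√(expectation ρB.1 u)) with h | h
  · obtain rfl : ρA = ρB := Density.ext_sqrt_expectation fun v hv => by
      have hv := hmax hv
      simpa [h, sub_eq_zero, sq_nonpos_iff] using hv
    simpa using zero_mem_costs_self ρA
  · obtain ⟨U, rfl⟩ := exists_unitary_mulVec_single hu
    rw [← expectation_inv_smul, ← expectation_inv_smul] at h ⊢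
    rw [← costs_smul ρA ρB U⁻¹]
    refine mem_costs_of_isMaxOn_single_zero (Real.sqrt_nonneg _) (Real.sqrt_nonneg _) h
      (Real.sq_sqrt (expectation_nonneg (U⁻¹ • ρA).2.1 _)).symm
      (Real.sq_sqrt (expectation_nonneg (U⁻¹ • ρB).2.1 _)).symm fun v hv => ?_
    simp only [expectation_inv_smul]
    exact hmax (mulVec_mem_unitVectors U hv)

theorem isLeast_transport (ρA ρB : Density 2) :
    IsLeast (costs (swapCost 2) ρA ρB) (transport (swapCost 2) ρA ρB) := by
  obtain ⟨u, -, h⟩ := exists_isLeast_costs ρA ρB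
  rwa [transport, h.csInf_eq]

theorem isGreatest_sqrtTransport (ρA ρB : Density 2) :
    IsGreatest ((fun u => |√(expectation ρA.1 u) / √2 - √(expectation ρB.1 u) / √2|) ''
      unitVectors (Fin 2)) (sqrtTransport (swapCost 2) ρA ρB) := by
  have abs_eq : ∀ u, |√(expectation ρA.1 u) / √2 - √(expectation ρB.1 u) / √2| =
      √((√(expectation ρA.1 u) - √(expectation ρB.1 u)) ^ 2 / 2) := fun u => by
    rw [← sub_div, abs_div, abs_of_nonneg (Real.sqrt_nonneg 2), Real.sqrt_div (sq_nonneg _),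
      Real.sqrt_sq_eq_abs]
  simp only [abs_eq]
  obtain ⟨u, hu, h⟩ := exists_isLeast_costs ρA ρB
  rw [sqrtTransport, transport, h.csInf_eq]
  refine ⟨⟨u, hu, rfl⟩, ?_⟩
  rintro _ ⟨v, hv, rfl⟩
  exact Real.sqrt_le_sqrt (sq_sub_sqrt_expectation_le_of_mem_costs h.1 hv)

theorem isMetric_sqrtTransport : IsMetric (sqrtTransport (swapCost 2)) := by
  refine .of_isGreatest isGreatest_sqrtTransport fun ρA ρB h =>
    Density.ext_sqrt_expectation fun u hu => ?_
  have h2 : √2 ≠ 0 := by positivity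
  exact (div_left_inj' h2).1 (h hu)

end Qubits

end QOT

theorem corollary7p3 :
    -- `T^Q_{C^Q}` is an attained, nonnegative minimum on `Ω_2`
    (∀ ρA ρB : QOT.Density 2,
      IsLeast (QOT.costs (QOT.swapCost 2) ρA ρB) (QOT.transport (QOT.swapCost 2) ρA ρB) ∧
      0 ≤ QOT.transport (QOT.swapCost 2) ρA ρB) ∧
    -- its square root is a metric
    QOT.IsMetric (QOT.sqrtTransport (QOT.swapCost 2)) ∧
    -- the Wasserstein-2 distance for `C^Q` is defined, and it is this square root
    (QOT.swapCost 2).PosSemidef ∧ QOT.VanishesExactlyOnSymmetric (QOT.swapCost 2) ∧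
    (∀ ρA ρB : QOT.Density 2,
      (∀ N : ℕ, IsLeast (QOT.chainLengths (QOT.sqrtTransport (QOT.swapCost 2)) N ρA ρB)
        (QOT.chainDist (QOT.sqrtTransport (QOT.swapCost 2)) N ρA ρB)) ∧
      Filter.Tendsto (fun N => QOT.chainDist (QOT.sqrtTransport (QOT.swapCost 2)) N ρA ρB)
        Filter.atTop (nhds (QOT.wasserstein (QOT.swapCost 2) ρA ρB)) ∧
      QOT.wasserstein (QOT.swapCost 2) ρA ρB = QOT.sqrtTransport (QOT.swapCost 2) ρA ρB) := by
  have hD := QOT.isMetric_sqrtTransport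
  refine ⟨fun ρA ρB => ⟨QOT.isLeast_transport ρA ρB,
    QOT.transport_nonneg QOT.swapCost_posSemidef ρA ρB⟩, hD, QOT.swapCost_posSemidef,
    QOT.swapCost_vanishesExactlyOnSymmetric,
    fun ρA ρB => ⟨fun N => ?_, ?_, hD.inducedDist_eq ρA ρB⟩⟩
  · rw [hD.chainDist_eq]
    exact hD.isLeast_chainLengths N ρA ρB
  · rw [QOT.wasserstein, hD.inducedDist_eq]
    exact hD.tendsto_chainDist ρA ρB
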